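/- All graphs are finite and simple. The eccentricity of a vertex is its largest distance to a vertex of the graph; the radius and the diameter of a graph are the minimum and the maximum eccentricity, and a graph is self-centered if these are equal. A graph $G$ is radially maximal if it is not complete and $\mathrm{rad}(G+e)<\mathrm{rad}(G)$ for every edge $e$ of its complement. The extension of $G$ at a vertex $v$ is obtained by adding one new vertex and joining it to $v$ and to all neighbours of $v$. Extending $G$ at $v$ successively $k$ times means starting from $G$ and performing $k$ extensions one after another, each at the original vertex $v$. Theorem 2. Let $r,d,n$ be positive integers. (1) Suppose $r\ge 2$ and $n\ge 2r$. Then there is a self-centered radially maximal graph of radius $r$ and order $n$. In fact, for every vertex $v$ of the cycle $C_{2r}$, the graph obtained from $C_{2r}$ by extending it successively $n-2r$ times at $v$ is such a graph. (2) Suppose $r<d\le 2r-2$ and $n\ge 3r-1$. Then there is a radially maximal graph of radius $r$, diameter $d$ and order $n$. In fact, let $H=H(r,d,3r-1)$ be the graph with the $3r-1$ vertices $x_1,\dots,x_{2r-1},y_1,\dots,y_r$ and the following edges, where $x_{2r}=x_1$: $x_ix_{i+1}$ for $1\le i\le 2r-1$; $x_{2r-1}y_1$; $x_{2r-2j+2}y_j$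 for $1\le j\le 2r-d$; $x_{d-r+1}y_{2r-d+1}$; and $y_ty_{t+1}$ for $2r-d+1\le t\le r-1$ (none if $d=r+1$). The graph obtained from $H$ by extending it successively $n-(3r-1)$ times at $x_{2r-2}$ is such a graph. -/

import Mathlib

namespace RadialMax

/-- A graph is radially maximal if it is not complete and joining any two distinct
nonadjacent vertices by a new edge strictly decreases the radius. -/
def IsRadiallyMaximal {V : Type*} (G : SimpleGraph V) : Prop :=
  G ≠ ⊤ ∧ ∀ u v : V, u ≠ v → ¬ G.Adj u v → (G ⊔ SimpleGraph.edge u v).radius < G.radius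

/-- A graph is self-centered if its radius equals its diameter. -/
def IsSelfCentered {V : Type*} (G : SimpleGraph V) : Prop :=
  G.radius = G.ediam

/-- The extension of `G` at `v`: one new vertex `none` is added, and it is joined to `v` and to
all the neighbours of `v`. -/
def extension {V : Type*} (G : SimpleGraph V) (v : V) : SimpleGraph (Option V) where
  Adj
    | some a, some b => G.Adj a b
    | none, some b => b = v ∨ G.Adj v b
    | some a, none => a = v ∨ G.Adj v a
    | none, none => False
  symm := ⟨by
    rintro (_ | a) (_ | b) h
    · exact h
    · exact h
    · exact h
    · exact SimpleGraph.Adj.symm (G := G) h⟩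
  loopless := ⟨by
    rintro (_ | a) h
    · exact h
    · exact G.irrefl h⟩

/-- The vertex set after `k` extensions. -/
def ExtVertex (V : Type*) : ℕ → Type _
  | 0 => V
  | k + 1 => Option (ExtVertex V k)

/-- The original vertex `v`, as a vertex of the graph obtained after `k` extensions. -/
def oldVertex {V : Type*} (v : V) : (k : ℕ) → ExtVertex V k
  | 0 => v
  | k + 1 => some (oldVertex v k)

/-- The graph obtained from `G` by `k` successive extensions at the vertex `v` of `G`. -/
def iterExtension {V : Type*} (G : SimpleGraph V) (v : V) :
    (k : ℕ) → SimpleGraph (ExtVertex V k)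
  | 0 => G
  | k + 1 => extension (iterExtension G v k) (oldVertex v k)

/-- The edges of the graph `H(r, d, 3r - 1)`, each listed in (at least) one direction. Here
`Sum.inl a` is the vertex `x_{a+1}` and `Sum.inr b` is the vertex `y_{b+1}`. -/
def hRel (r d : ℕ) : Fin (2 * r - 1) ⊕ Fin r → Fin (2 * r - 1) ⊕ Fin r → Prop
  -- `x_i x_{i+1}` for `1 ≤ i ≤ 2r-1`, where `x_{2r} = x_1`
  | .inl a, .inl a' =>
      let i := a.val + 1
      let i' := a'.val + 1
      i' = i + 1 ∨ (i = 2 * r - 1 ∧ i' = 1)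
  -- `x_{2r-1} y_1`; `x_{2r-2j+2} y_j` for `1 ≤ j ≤ 2r-d`, where `x_{2r} = x_1`;
  -- `x_{d-r+1} y_{2r-d+1}`
  | .inl a, .inr b =>
      let i := a.val + 1
      let j := b.val + 1
      (i = 2 * r - 1 ∧ j = 1) ∨
      (j + d ≤ 2 * r ∧ (i + 2 * j = 2 * r + 2 ∨ (j = 1 ∧ i = 1))) ∨
      (i + r = d + 1 ∧ j + d = 2 * r + 1)
  -- `y_t y_{t+1}` for `2r-d+1 ≤ t ≤ r-1`
  | .inr b, .inr b' =>
      let t := b.val + 1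
      let t' := b'.val + 1
      2 * r + 1 ≤ t + d ∧ t' = t + 1
  | .inr _, .inl _ => False

/-- The graph `H(r, d, 3r - 1)`, on the vertices `x_1, …, x_{2r-1}, y_1, …, y_r`. -/
def graphH (r d : ℕ) : SimpleGraph (Fin (2 * r - 1) ⊕ Fin r) :=
  SimpleGraph.fromRel (hRel r d)

end RadialMax

/-! An extension at v adds an adjacent twin of v. Distances between old vertices are unchanged, so
radius and diameter survive. Radial maximality survives once it is strengthened: if the new edge is
at v, the vertex of eccentricity at most r - 1 that it creates can be chosen within r - 2 of v, so
the twin stays within r - 1. `ExtInvariant` packages this and `ExtInvariant.extension` is the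
induction step. It remains to treat the two starting graphs.

In C_{2r} each vertex has a unique vertex at distance r, and a chord ab brings the antipode of a
closer to a.

In H, put m = d - r. The x's form an odd cycle X of length 2r - 1, whose vertices are pairwise
within r - 1. So X c has eccentricity r only because of what hangs off the opposite side: P i alone
for c = 2i - r and c = 2i - r + 1 (m + 1 ≤ i ≤ r - 1), Q alone for c = r, and some of the T's for r
+ 1 ≤ c ≤ r + 2m, only T m at both ends. These c fill one period exactly. `Frame.exists_shrink`
finds, for each added edge, an X c that now reaches its far vertices within r - 1. The extra clause
at x_{2r-2} comes for free from the leaf y_2 attached there. Explicit lower bounds on distances come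
from integer functions changing by at most 1 along edges (`Near.sub_le`, `heightFun`). -/

namespace RadialMax

variable {V W : Type*}

/-! ### Walks of bounded length -/

/-- `u` and `v` are joined by a walk of length at most `k`. -/
def Near (G : SimpleGraph V) (k : ℤ) (u v : V) : Prop :=
  ∃ p : G.Walk u v, (p.length : ℤ) ≤ k

namespace Near

variable {G : SimpleGraph V} {G' : SimpleGraph W} {k l : ℤ} {u v w : V}

theorem refl (hk : 0 ≤ k) (u : V) : Near G k u u := ⟨.nil, by simpa using hk⟩

theorem of_adj (h : G.Adj u v) : Near G 1 u v := ⟨h.toWalk, by simp⟩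

theorem symm (h : Near G k u v) : Near G k v u := by
  obtain ⟨p, hp⟩ := h
  exact ⟨p.reverse, by simpa using hp⟩

theorem mono (h : Near G k u v) (hkl : k ≤ l) : Near G l u v := by
  obtain ⟨p, hp⟩ := h
  exact ⟨p, hp.trans hkl⟩

theorem trans (h : Near G k u v) (h' : Near G l v w) : Near G (k + l) u w := by
  obtain ⟨p, hp⟩ := h
  obtain ⟨q, hq⟩ := h'
  exact ⟨p.append q, by rw [SimpleGraph.Walk.length_append]; push_cast; omega⟩

/-- Edges may be collapsed, not only mapped to edges: this admits the retraction of an extension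
that merges the twins. -/
theorem map {f : V → W} (hf : ∀ a b, G.Adj a b → Near G' 1 (f a) (f b)) (h : Near G k u v) :
    Near G' k (f u) (f v) := by
  obtain ⟨p, hp⟩ := h
  refine mono ?_ hp
  clear hp
  induction p with
  | nil => exact refl (by simp) _
  | cons h p ih =>
    refine ((hf _ _ h).trans ih).mono ?_
    rw [SimpleGraph.Walk.length_cons]
    push_cast
    omega

theorem of_le {H : SimpleGraph V} (hle : G ≤ H) (h : Near G k u v) : Near H k u v :=
  h.map (f := id) fun _ _ hab => of_adj (hle hab)

theorem sub_le {f : V → ℤ} (hf : ∀ a b, G.Adj a b → f b ≤ f a + 1) (h : Near G k u v) :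
    f v - f u ≤ k := by
  obtain ⟨p, hp⟩ := h
  refine le_trans ?_ hp
  clear hp
  induction p with
  | nil => simp
  | cons h p ih =>
    have := hf _ _ h
    rw [SimpleGraph.Walk.length_cons]
    push_cast
    omega

theorem edist_le {n : ℕ} (h : Near G k u v) (hk : k ≤ n) : G.edist u v ≤ n := by
  obtain ⟨p, hp⟩ := h
  exact (SimpleGraph.edist_le p).trans (by exact_mod_cast hp.trans hk)

theorem le_edist {n : ℕ} (h : ∀ k, Near G k u v → (n : ℤ) ≤ k) : (n : ℕ∞) ≤ G.edist u v :=
  le_iInf fun p => by exact_mod_cast h p.length ⟨p, le_rfl⟩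

end Near

/-! ### The invariant and its persistence under extension -/

/-- Radius `r`, diameter `d`, and every new edge produces a vertex of eccentricity less than `r`;
if the new edge is at `v`, this vertex has distance at most `r - 2` from `v`. -/
structure ExtInvariant (G : SimpleGraph V) (v : V) (r d : ℤ) : Prop where
  two_le : 2 ≤ r
  far : ∀ u, ∃ w, ∀ k, Near G k u w → r ≤ k
  center : ∃ u, ∀ w, Near G r u w
  near : ∀ u w, Near G d u w
  far_pair : ∃ u w, ∀ k, Near G k u w → d ≤ k
  shrink : ∀ a b, a ≠ b → ¬ G.Adj a b → ∃ u,
    (∀ w, Near (G ⊔ SimpleGraph.edge a b) (r - 1) u w) ∧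
    (a = v → Near (G ⊔ SimpleGraph.edge a b) (r - 2) u v)

namespace ExtInvariant

variable {G : SimpleGraph V} {v : V}

theorem radius_eq {r : ℕ} {d : ℤ} (h : ExtInvariant G v r d) : G.radius = r := by
  apply le_antisymm
  · obtain ⟨u, hu⟩ := h.center
    exact SimpleGraph.radius_le_eccent.trans (iSup_le fun w => (hu w).edist_le le_rfl)
  · refine le_iInf fun u => ?_
    obtain ⟨w, hw⟩ := h.far u
    exact (Near.le_edist hw).trans SimpleGraph.edist_le_eccent

theorem ediam_eq {r : ℤ} {d : ℕ} (h : ExtInvariant G v r d) : G.ediam = d := by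
  apply le_antisymm
  · exact SimpleGraph.ediam_le_of_edist_le fun u w => (h.near u w).edist_le le_rfl
  · obtain ⟨u, w, hw⟩ := h.far_pair
    exact (Near.le_edist hw).trans SimpleGraph.edist_le_ediam

theorem isRadiallyMaximal {r : ℕ} {d : ℤ} (h : ExtInvariant G v r d) : IsRadiallyMaximal G := by
  have h2 := h.two_le
  constructor
  · rintro rfl
    obtain ⟨w, hw⟩ := h.far v
    by_cases hvw : v = w
    · subst hvw
      have := hw 0 (Near.refl le_rfl _)
      omega
    · have := hw 1 (Near.of_adj hvw)
      omega
  · intro a b hab hadj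
    obtain ⟨u, hu, -⟩ := h.shrink a b hab hadj
    rw [h.radius_eq]
    have hle : (G ⊔ SimpleGraph.edge a b).radius ≤ ((r - 1 : ℕ) : ℕ∞) :=
      SimpleGraph.radius_le_eccent.trans (iSup_le fun w => (hu w).edist_le (by omega))
    refine hle.trans_lt ?_
    exact_mod_cast (by omega : r - 1 < r)

theorem of_iso {G' : SimpleGraph W} {r d : ℤ} (h : ExtInvariant G v r d) (e : G ≃g G') :
    ExtInvariant G' (e v) r d := by
  have hf : ∀ {k u w}, Near G k u w → Near G' k (e u) (e w) := fun h =>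
    h.map (f := e) fun a b hab => Near.of_adj (e.map_adj_iff.2 hab)
  have hb : ∀ {k u w}, Near G' k (e u) (e w) → Near G k u w := fun h => by
    simpa using h.map (f := e.symm) fun a b hab => Near.of_adj (e.symm.map_adj_iff.2 hab)
  have key : ∀ {k u w a b}, Near (G ⊔ SimpleGraph.edge a b) k u w →
      Near (G' ⊔ SimpleGraph.edge (e a) (e b)) k (e u) (e w) := fun h =>
    h.map (f := e) fun x y hxy => Near.of_adj (by
      simp only [SimpleGraph.sup_adj, SimpleGraph.edge_adj, ne_eq, e.map_adj_iff,
        e.injective.eq_iff] at hxy ⊢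
      exact hxy)
  refine ⟨h.two_le, ?_, ?_, ?_, ?_, ?_⟩
  · refine e.surjective.forall.2 fun u => ?_
    obtain ⟨w, hw⟩ := h.far u
    exact ⟨e w, fun k hk => hw k (hb hk)⟩
  · obtain ⟨u, hu⟩ := h.center
    exact ⟨e u, e.surjective.forall.2 fun w => hf (hu w)⟩
  · exact e.surjective.forall.2 fun u => e.surjective.forall.2 fun w => hf (h.near u w)
  · obtain ⟨u, w, huw⟩ := h.far_pair
    exact ⟨e u, e w, fun k hk => huw k (hb hk)⟩
  · refine e.surjective.forall.2 fun a => e.surjective.forall.2 fun b hab hadj => ?_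
    obtain ⟨u, hu, hv⟩ := h.shrink a b (fun h => hab (congrArg e h))
      (fun h => hadj (e.map_adj_iff.2 h))
    exact ⟨e u, e.surjective.forall.2 fun w => key (hu w),
      fun hav => key (hv (e.injective hav))⟩

/-- Invariance under extension at the distinguished vertex. -/
theorem extension {r d : ℤ} (h : ExtInvariant G v r d) :
    ExtInvariant (extension G v) (some v) r d := by
  classical
  have hr := h.two_le
  set E := RadialMax.extension G v with hE
  have hsome : ∀ {k u w}, Near G k u w → Near E k (some u) (some w) := fun h =>
    h.map (f := some) fun a b hab => Near.of_adj hab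
  -- ρ merges the new vertex with v and bounds distances in the extension from below.
  let ρ : Option V → V := fun x => x.getD v
  have hback : ∀ {k x y}, Near E k x y → Near G k (ρ x) (ρ y) := fun h =>
    h.map (f := ρ) fun a b hab => by
      rcases a with _ | a <;> rcases b with _ | b
      · exact hab.elim
      · rcases (hab : b = v ∨ G.Adj v b) with rfl | hab
        · exact Near.refl (by norm_num) _
        · exact Near.of_adj hab
      · rcases (hab : a = v ∨ G.Adj v a) with rfl | hab
        · exact Near.refl (by norm_num) _
        · exact Near.of_adj hab.symm
      · exact Near.of_adj hab
  -- σ is a second copy of the original graph, in which the new vertex plays the role of v; edges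
  -- added at the new vertex are handled through it.
  let σ : V → Option V := fun a => if a = v then none else some a
  have hσv : σ v = none := if_pos rfl
  have hσ : ∀ {a}, a ≠ v → σ a = some a := fun h => if_neg h
  have hσadj : ∀ {a b}, G.Adj a b → E.Adj (σ a) (σ b) := by
    intro a b hab
    by_cases ha : a = v <;> by_cases hb : b = v
    · subst ha hb; exact (G.irrefl hab).elim
    · subst ha; rw [hσv, hσ hb]; exact Or.inr hab
    · subst hb; rw [hσv, hσ ha]; exact Or.inr hab.symm
    · rw [hσ ha, hσ hb]; exact hab
  have hσnear : ∀ {k u w}, Near G k u w → Near E k (σ u) (σ w) := fun h =>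
    h.map (f := σ) fun a b hab => Near.of_adj (hσadj hab)
  have htwin : E.Adj none (some v) := Or.inl rfl
  -- The bound 1 ≤ k is needed for the twins alone, which have the same image under ρ.
  have hup : ∀ {k x y}, 1 ≤ k → Near G k (ρ x) (ρ y) → Near E k x y := by
    intro k x y hk hxy
    rcases x with _ | x <;> rcases y with _ | y
    · exact Near.refl (by omega) _
    · by_cases hy : y = v
      · subst hy; exact (Near.of_adj htwin).mono hk
      · simpa [ρ, hσv, hσ hy] using hσnear hxy
    · by_cases hx : x = v
      · subst hx; exact (Near.of_adj htwin.symm).mono hk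
      · simpa [ρ, hσv, hσ hx] using hσnear hxy
    · exact hsome hxy
  have hd : 1 ≤ d := by
    obtain ⟨w, hw⟩ := h.far v
    have := hw _ (h.near v w)
    omega
  refine ⟨h.two_le, fun x => ?_, ?_, fun x y => hup hd (h.near _ _), ?_, ?_⟩
  · obtain ⟨w, hw⟩ := h.far (ρ x)
    exact ⟨some w, fun k hk => hw k (hback hk)⟩
  · obtain ⟨u, hu⟩ := h.center
    exact ⟨some u, fun w => hup (by omega) (hu _)⟩
  · obtain ⟨u, w, huw⟩ := h.far_pair
    exact ⟨some u, some w, fun k hk => huw k (hback hk)⟩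
  have key : ∀ {a b k u w}, Near (G ⊔ SimpleGraph.edge a b) k u w →
      Near (E ⊔ SimpleGraph.edge (some a) (some b)) k (some u) (some w) := fun h =>
    h.map (f := some) fun x y hxy => Near.of_adj (by
      simp only [SimpleGraph.sup_adj, SimpleGraph.edge_adj, ne_eq,
        Option.some_inj] at hxy ⊢
      exact hxy)
  have keyσ : ∀ {a b k u w}, Near (G ⊔ SimpleGraph.edge a b) k u w →
      Near (E ⊔ SimpleGraph.edge (σ a) (σ b)) k (σ u) (σ w) := fun h =>
    h.map (f := σ) fun x y hxy => Near.of_adj (by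
      have hinj : Function.Injective σ := by
        intro x y hxy
        by_cases hx : x = v <;> by_cases hy : y = v
        · rw [hx, hy]
        · subst hx; simp [hσv, hσ hy] at hxy
        · subst hy; simp [hσv, hσ hx] at hxy
        · simpa [hσ hx, hσ hy] using hxy
      simp only [SimpleGraph.sup_adj, SimpleGraph.edge_adj, ne_eq, hinj.eq_iff] at hxy ⊢
      exact hxy.imp hσadj id)
  have hone : ∀ {a b}, Near (E ⊔ SimpleGraph.edge a b) 1 none (some v) := fun {a b} =>
    (Near.of_adj htwin).of_le le_sup_left
  -- a new edge at the distinguished vertex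
  have hnew : ∀ b, b ≠ v → ¬ G.Adj v b → ∃ u,
      (∀ w, Near (E ⊔ SimpleGraph.edge (some v) (some b)) (r - 1) u w) ∧
      Near (E ⊔ SimpleGraph.edge (some v) (some b)) (r - 2) u (some v) := by
    intro b hb hadj
    obtain ⟨u, hu, hv⟩ := h.shrink v b hb.symm hadj
    refine ⟨some u, ?_, key (hv rfl)⟩
    rintro (_ | w)
    · exact ((key (hv rfl)).trans hone.symm).mono (by omega)
    · exact key (hu w)
  -- a new edge at the added vertex
  have hnone : ∀ b, b ≠ v → ¬ G.Adj v b → ∃ u,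
      (∀ w, Near (E ⊔ SimpleGraph.edge none (some b)) (r - 1) u w) := by
    intro b hb hadj
    obtain ⟨u, hu, hv⟩ := h.shrink v b hb.symm hadj
    have hu' : ∀ w, Near (E ⊔ SimpleGraph.edge none (some b)) (r - 1) (σ u) (σ w) := fun w => by
      simpa [hσv, hσ hb] using keyσ (hu w)
    have hv' : Near (E ⊔ SimpleGraph.edge none (some b)) (r - 2) (σ u) none := by
      simpa [hσv, hσ hb] using keyσ (hv rfl)
    refine ⟨σ u, ?_⟩
    rintro (_ | w)
    · exact hv'.mono (by omega)
    · by_cases hw : w = v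
      · subst hw; exact (hv'.trans hone).mono (by omega)
      · simpa [hσ hw] using hu' w
  rintro (_ | a) (_ | b) hab hadj
  · exact (hab rfl).elim
  · obtain ⟨u, hu⟩ := hnone b (fun h => hadj (Or.inl h)) (fun h => hadj (Or.inr h))
    exact ⟨u, hu, by simp⟩
  · have hav : a ≠ v := fun h => hadj (Or.inl h)
    obtain ⟨u, hu⟩ := hnone a hav (fun h => hadj (Or.inr h))
    rw [SimpleGraph.edge_comm] at hu
    exact ⟨u, hu, fun h => (hav (Option.some_inj.1 h)).elim⟩
  · have hab' : a ≠ b := fun h => hab (congrArg some h)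
    by_cases ha : a = v
    · subst ha
      obtain ⟨u, hu, hv⟩ := hnew b hab'.symm hadj
      exact ⟨u, hu, fun _ => hv⟩
    · by_cases hb : b = v
      · subst hb
        obtain ⟨u, hu, -⟩ := hnew a ha (fun h => hadj (SimpleGraph.Adj.symm (G := G) h))
        rw [SimpleGraph.edge_comm] at hu
        exact ⟨u, hu, fun h => (ha (Option.some_inj.1 h)).elim⟩
      · obtain ⟨u, hu, -⟩ := h.shrink a b hab' hadj
        refine ⟨some u, ?_, fun h => (ha (Option.some_inj.1 h)).elim⟩
        rintro (_ | w)
        -- The twin is adjacent to u if u = v; otherwise σ fixes u, a and b and carries v to the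
        -- twin.
        · by_cases huv : u = v
          · subst huv; exact hone.symm.mono (by omega)
          · simpa [hσv, hσ ha, hσ hb, hσ huv] using keyσ (hu v)
        · exact key (hu w)

theorem iterExtension {r d : ℤ} (h : ExtInvariant G v r d) (k : ℕ) :
    ExtInvariant (iterExtension G v k) (oldVertex v k) r d := by
  induction k with
  | zero => exact h
  | succ k ih => exact ih.extension

end ExtInvariant

/-! ### Order of the iterated extension -/

theorem nonempty_extVertex_equiv {n : ℕ} (e : V ≃ Fin n) (k : ℕ) :
    Nonempty (ExtVertex V k ≃ Fin (n + k)) := by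
  induction k with
  | zero => exact ⟨e⟩
  | succ k ih =>
    obtain ⟨e'⟩ := ih
    exact ⟨(Equiv.optionCongr e').trans (finSuccEquiv (n + k)).symm⟩

/-- A copy of the iterated extension on `Fin n`. -/
theorem ExtInvariant.exists_fin {G : SimpleGraph V} {v : V} {r d : ℤ} (h : ExtInvariant G v r d)
    {n₀ n : ℕ} (e : V ≃ Fin n₀) (hn : n₀ ≤ n) :
    ∃ (H : SimpleGraph (Fin n)) (w : Fin n), ExtInvariant H w r d ∧
      Nonempty (H ≃g RadialMax.iterExtension G v (n - n₀)) := by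
  obtain ⟨f⟩ := nonempty_extVertex_equiv e (n - n₀)
  rw [Nat.add_sub_cancel' hn] at f
  exact ⟨_, _, (h.iterExtension _).of_iso (SimpleGraph.Iso.map f _),
    ⟨(SimpleGraph.Iso.map f _).symm⟩⟩

/-! ### Closed walks and frames: upper bounds for distances -/

theorem Near.of_sequence {G : SimpleGraph W} {X : ℤ → W} (hX : ∀ i, G.Adj (X i) (X (i + 1)))
    {i j k : ℤ} (h : i - j ≤ k) (h' : j - i ≤ k) : Near G k (X i) (X j) := by
  have step : ∀ n : ℕ, ∀ i, Near G n (X i) (X (i + n)) := by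
    intro n
    induction n with
    | zero => intro i; simpa using Near.refl le_rfl _
    | succ n ih =>
      intro i
      have := (ih i).trans (Near.of_adj (hX (i + n)))
      push_cast
      rwa [add_assoc] at this
  rcases le_total i j with hij | hij
  · have := step (j - i).toNat i
    rw [show i + ((j - i).toNat : ℤ) = j by omega] at this
    exact this.mono (by omega)
  · have := step (i - j).toNat j
    rw [show j + ((i - j).toNat : ℤ) = i by omega] at this
    exact this.symm.mono (by omega)

/-- Coordinates exhibiting the edges of `H(r, r + m, 3r - 1)`: a closed walk `X` of length `2r - 1`,
pendant vertices `P i` at `X (2i)`, a vertex `Q` joined to `X 0` and `X 1`, and a path `T 1, …, T m`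
at `X (m + 1)`. -/
structure Frame (G : SimpleGraph W) (r m : ℤ) (X P T : ℤ → W) (Q : W) : Prop where
  one_le : 1 ≤ m
  le : m + 2 ≤ r
  adj_X : ∀ i, G.Adj (X i) (X (i + 1))
  periodic : ∀ i k, X (i + (2 * r - 1) * k) = X i
  adj_P : ∀ i, m + 1 ≤ i → i ≤ r - 1 → G.Adj (P i) (X (2 * i))
  adj_Q : G.Adj Q (X 0)
  adj_Q' : G.Adj Q (X 1)
  adj_T_one : G.Adj (T 1) (X (m + 1))
  adj_T : ∀ h, 1 ≤ h → h < m → G.Adj (T h) (T (h + 1))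
  cases : ∀ w, (∃ i, w = X i) ∨ (∃ i, m + 1 ≤ i ∧ i ≤ r - 1 ∧ w = P i) ∨ w = Q ∨
    ∃ h, 1 ≤ h ∧ h ≤ m ∧ w = T h

namespace Frame

variable {G : SimpleGraph W} {r m : ℤ} {X P T : ℤ → W} {Q : W}

/-- A frame records only the presence of edges, so it survives the added edge and all its upper
bounds hold in the larger graph. -/
theorem of_le {G' : SimpleGraph W} (F : Frame G r m X P T Q) (hle : G ≤ G') :
    Frame G' r m X P T Q where
  one_le := F.one_le
  le := F.le
  adj_X i := hle (F.adj_X i)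
  periodic := F.periodic
  adj_P i h h' := hle (F.adj_P i h h')
  adj_Q := hle F.adj_Q
  adj_Q' := hle F.adj_Q'
  adj_T_one := hle F.adj_T_one
  adj_T h h1 h2 := hle (F.adj_T h h1 h2)
  cases := F.cases

variable (F : Frame G r m X P T Q)
include F

theorem periodic_add (i : ℤ) : X (i + (2 * r - 1)) = X i := by
  simpa using F.periodic i 1

theorem periodic_sub (i : ℤ) : X (i - (2 * r - 1)) = X i := by
  simpa [sub_eq_add_neg] using F.periodic i (-1)

theorem exists_rep (i lo : ℤ) : ∃ j, lo ≤ j ∧ j < lo + (2 * r - 1) ∧ X i = X j := by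
  have hpos : 0 < 2 * r - 1 := by have := F.one_le; have := F.le; omega
  refine ⟨lo + (i - lo) % (2 * r - 1), ?_, ?_, ?_⟩
  · have := Int.emod_nonneg (i - lo) hpos.ne'
    omega
  · have := Int.emod_lt_of_pos (i - lo) hpos
    omega
  · rw [← F.periodic i (-((i - lo) / (2 * r - 1)))]
    congr 1
    have := Int.emod_add_mul_ediv (i - lo) (2 * r - 1)
    linarith

theorem near_X {i j k : ℤ} (h : i - j ≤ k) (h' : j - i ≤ k) : Near G k (X i) (X j) :=
  Near.of_sequence F.adj_X h h'

theorem near_X_X (i j : ℤ) : Near G (r - 1) (X i) (X j) := by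
  obtain ⟨j', h1, h2, h3⟩ := F.exists_rep j (i - (r - 1))
  rw [h3]
  exact F.near_X (by omega) (by omega)

theorem near_T_T {g h k : ℤ} (hg : 1 ≤ g) (hgm : g ≤ m) (hh : 1 ≤ h) (hhm : h ≤ m)
    (h1 : g - h ≤ k) (h2 : h - g ≤ k) : Near G k (T g) (T h) := by
  have step : ∀ n : ℕ, ∀ i, 1 ≤ i → i + n ≤ m → Near G n (T i) (T (i + n)) := by
    intro n
    induction n with
    | zero => intro i _ _; simpa using Near.refl le_rfl _
    | succ n ih =>
      intro i hi him
      have := (ih i hi (by push_cast at him; omega)).trans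
        (Near.of_adj (F.adj_T (i + n) (by omega) (by push_cast at him; omega)))
      push_cast
      rwa [add_assoc] at this
  rcases le_total g h with hij | hij
  · have := step (h - g).toNat g hg (by omega)
    rw [show g + ((h - g).toNat : ℤ) = h by omega] at this
    exact this.mono (by omega)
  · have := step (g - h).toNat h hh (by omega)
    rw [show h + ((g - h).toNat : ℤ) = g by omega] at this
    exact this.symm.mono (by omega)

theorem near_X_T {h : ℤ} (hh : 1 ≤ h) (hm : h ≤ m) : Near G h (X (m + 1)) (T h) :=
  ((Near.of_adj F.adj_T_one).symm.trans
    (F.near_T_T le_rfl F.one_le hh hm (k := h - 1) (by omega) (by omega))).mono (by omega)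

theorem near_X_P {i : ℤ} (h1 : m + 1 ≤ i) (h2 : i ≤ r - 1) : Near G 1 (X (2 * i)) (P i) :=
  (Near.of_adj (F.adj_P i h1 h2)).symm

/-- The number s counts turns around the closed walk; it selects the representative of i, hence the
direction of travel. -/
theorem X_shift {i j k : ℤ} (s : ℤ) (h : i + (2 * r - 1) * s - j ≤ k)
    (h' : j - (i + (2 * r - 1) * s) ≤ k) : Near G k (X i) (X j) := by
  rw [← F.periodic i s]
  exact F.near_X h h'

theorem X_P_shift {i j k : ℤ} (s : ℤ) (h1 : m + 1 ≤ i) (h2 : i ≤ r - 1)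
    (h : j + (2 * r - 1) * s - 2 * i ≤ k - 1) (h' : 2 * i - (j + (2 * r - 1) * s) ≤ k - 1) :
    Near G k (X j) (P i) :=
  ((F.X_shift s h h').trans (F.near_X_P h1 h2)).mono (by omega)

theorem X_Q_shift {j k : ℤ} (s : ℤ)
    (h : j + (2 * r - 1) * s ≤ k) (h' : - (j + (2 * r - 1) * s) ≤ k - 1) :
    Near G k (X j) Q := by
  rcases le_or_gt (j + (2 * r - 1) * s) 0 with hj | hj
  · exact ((F.X_shift (j := 0) (k := k - 1) s (by omega) (by omega)).trans
      (Near.of_adj F.adj_Q).symm).mono (by omega)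
  · exact ((F.X_shift (j := 1) (k := k - 1) s (by omega) (by omega)).trans
      (Near.of_adj F.adj_Q').symm).mono (by omega)

theorem X_T_shift {j h k : ℤ} (s : ℤ) (h1 : 1 ≤ h) (h2 : h ≤ m)
    (hk : j + (2 * r - 1) * s - (m + 1) ≤ k - h) (hk' : m + 1 - (j + (2 * r - 1) * s) ≤ k - h) :
    Near G k (X j) (T h) :=
  ((F.X_shift s hk hk').trans (F.near_X_T h1 h2)).mono (by omega)

/-! ### Vertices of the closed walk and their far vertices -/

/-- X (2i) is opposite these two positions, so P i is the only vertex that the frame alone does not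
place within r - 1; `center_Q` and `center_T` play the same role at the other positions. -/
theorem center_P {c i : ℤ} (h1 : m + 1 ≤ i) (h2 : i ≤ r - 1) (hc : c = 2 * i - r ∨ c = 2 * i - r + 1)
    (h : Near G (r - 1) (X c) (P i)) (w : W) : Near G (r - 1) (X c) w := by
  have hm := F.one_le
  have hmr := F.le
  rcases F.cases w with ⟨j, rfl⟩ | ⟨j, hj1, hj2, rfl⟩ | rfl | ⟨g, hg1, hg2, rfl⟩
  · exact F.near_X_X _ _
  · rcases lt_trichotomy j i with hji | rfl | hji
    · exact F.X_P_shift 0 hj1 hj2 (by omega) (by omega)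
    · exact h
    · exact F.X_P_shift 1 hj1 hj2 (by omega) (by omega)
  · exact F.X_Q_shift 0 (by omega) (by omega)
  · exact F.X_T_shift 0 hg1 hg2 (by omega) (by omega)

theorem center_Q (h : Near G (r - 1) (X r) Q) (w : W) : Near G (r - 1) (X r) w := by
  have hm := F.one_le
  have hmr := F.le
  rcases F.cases w with ⟨j, rfl⟩ | ⟨j, hj1, hj2, rfl⟩ | rfl | ⟨g, hg1, hg2, rfl⟩
  · exact F.near_X_X _ _
  · exact F.X_P_shift 0 hj1 hj2 (by omega) (by omega)
  · exact h
  · exact F.X_T_shift 0 hg1 hg2 (by omega) (by omega)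

theorem center_T {c : ℤ} (h1 : r + 1 ≤ c) (h2 : c ≤ r + 2 * m)
    (h : ∀ g, 1 ≤ g → g ≤ m → Near G (r - 1) (X c) (T g)) (w : W) : Near G (r - 1) (X c) w := by
  have hm := F.one_le
  have hmr := F.le
  rcases F.cases w with ⟨j, rfl⟩ | ⟨j, hj1, hj2, rfl⟩ | rfl | ⟨g, hg1, hg2, rfl⟩
  · exact F.near_X_X _ _
  · exact F.X_P_shift 0 hj1 hj2 (by omega) (by omega)
  · exact F.X_Q_shift (-1) (by omega) (by omega)
  · exact h g hg1 hg2

/-- At both ends of the arc r + 1, …, r + 2m the foot X (m + 1) is r - m steps away, so only T m is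
left to check. -/
theorem center_T_top {c : ℤ} (hc : c = r + 1 ∨ c = r + 2 * m)
    (h : Near G (r - 1) (X c) (T m)) (w : W) : Near G (r - 1) (X c) w := by
  have hm := F.one_le
  have hmr := F.le
  refine F.center_T (by omega) (by omega) (fun g hg1 hg2 => ?_) w
  rcases eq_or_lt_of_le hg2 with rfl | hgm
  · exact h
  · rcases hc with rfl | rfl
    · exact F.X_T_shift 0 hg1 hg2 (by omega) (by omega)
    · exact F.X_T_shift (-1) hg1 hg2 (by omega) (by omega)

theorem near_all (u w : W) : Near G (r + m) u w := by
  have hm := F.one_le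
  have hmr := F.le
  have low : ∀ w, (∃ i, Near G 1 (X i) w) ∨ ∃ h, 1 ≤ h ∧ h ≤ m ∧ w = T h := fun w => by
    rcases F.cases w with ⟨j, rfl⟩ | ⟨j, hj1, hj2, rfl⟩ | rfl | h
    · exact .inl ⟨j, Near.refl (by norm_num) _⟩
    · exact .inl ⟨_, F.near_X_P hj1 hj2⟩
    · exact .inl ⟨_, (Near.of_adj F.adj_Q).symm⟩
    · exact .inr h
  rcases low u with ⟨i, hi⟩ | ⟨g, hg1, hg2, rfl⟩ <;> rcases low w with ⟨j, hj⟩ | ⟨h, hh1, hh2, rfl⟩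
  · exact ((hi.symm.trans (F.near_X_X i j)).trans hj).mono (by omega)
  · exact ((hi.symm.trans (F.near_X_X i _)).trans (F.near_X_T hh1 hh2)).mono (by omega)
  · exact (((F.near_X_T hg1 hg2).symm.trans (F.near_X_X _ j)).trans hj).mono (by omega)
  · exact F.near_T_T hg1 hg2 hh1 hh2 (by omega) (by omega)

theorem exists_center : ∃ u, ∀ w, Near G r u w := by
  have hm := F.one_le
  have hmr := F.le
  refine ⟨X r, fun w => ?_⟩
  rcases F.cases w with ⟨j, rfl⟩ | ⟨j, hj1, hj2, rfl⟩ | rfl | ⟨g, hg1, hg2, rfl⟩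
  · exact (F.near_X_X _ _).mono (by omega)
  · exact F.X_P_shift 0 hj1 hj2 (by omega) (by omega)
  · exact F.X_Q_shift 0 (by omega) (by omega)
  · exact F.X_T_shift 0 hg1 hg2 (by omega) (by omega)

/-! ### The effect of an additional edge -/

omit F in
theorem near_via {a b c t : W} (k l : ℤ) (hab : G.Adj a b) (h1 : Near G k c a) (h2 : Near G l b t)
    (hkl : k + 1 + l ≤ r - 1) : Near G (r - 1) c t :=
  ((h1.trans (Near.of_adj hab)).trans h2).mono hkl

/-- In this window X a has a single far vertex, some P i or Q. The chord shortens the way there from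
X a or, failing that, the way from X b to its own far vertex. -/
theorem chord_window {a b : ℤ} (hab : G.Adj (X a) (X b)) (ha : 2 * m + 2 - r ≤ a) (ha' : a ≤ r)
    (hb : a + 2 ≤ b) (hb' : b ≤ a + 2 * r - 3) : ∃ c, ∀ w, Near G (r - 1) (X c) w := by
  have hm := F.one_le
  have hmr := F.le
  have refl : Near G 0 (X a) (X a) := Near.refl le_rfl _
  -- For a = r the two ways to Q are equally long, so every chord saves a step.
  rcases eq_or_lt_of_le ha' with rfl | har
  · refine ⟨_, F.center_Q (near_via 0 (a - 2) hab refl ?_ (by omega))⟩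
    rcases le_or_gt b (2 * a - 1) with h | h
    · exact F.X_Q_shift (-1) (by omega) (by omega)
    · exact F.X_Q_shift (-1) (by omega) (by omega)
  obtain ⟨i, hi⟩ : ∃ i, a = 2 * i - r ∨ a = 2 * i - r + 1 := ⟨(a + r) / 2, by omega⟩
  have hi1 : m + 1 ≤ i := by omega
  have hi2 : i ≤ r - 1 := by omega
  rcases hi with hi | hi
  -- From a = 2i - r, X (2i) is r steps forward but r - 1 backward, so the chord to a + 2 saves
  -- nothing for X a. It does for X (a + 2), which is opposite P (i + 1), or Q if i = r - 1.
  · rcases eq_or_lt_of_le hb with hb2 | hb2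
    · rcases eq_or_lt_of_le hi2 with hir | hir
      · obtain rfl : b = r := by omega
        exact ⟨_, F.center_Q (near_via 0 (b - 2) hab.symm (Near.refl le_rfl _)
          (F.X_Q_shift 0 (by omega) (by omega)) (by omega))⟩
      · exact ⟨b, F.center_P (i := i + 1) (by omega) (by omega) (by omega)
          (near_via 0 (r - 2) hab.symm (Near.refl le_rfl _)
          (F.X_P_shift 1 (by omega) (by omega) (by omega) (by omega)) (by omega))⟩
    · exact ⟨a, F.center_P hi1 hi2 (by omega) (near_via 0 (r - 2) hab refl
        (F.X_P_shift 0 hi1 hi2 (by omega) (by omega)) (by omega))⟩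
  -- Mirror image: the useless chord leads to a - 2, which is opposite P (i - 1), or is the end r +
  -- 2m of the T-arc if i = m + 1.
  · rcases eq_or_lt_of_le hb' with hb2 | hb2
    · rcases eq_or_lt_of_le hi1 with hir | hir
      · refine ⟨b, F.center_T_top (by omega) (near_via 0 (r - 2) hab.symm (Near.refl le_rfl _)
          (F.X_T_shift 0 hm le_rfl (by omega) (by omega)) (by omega))⟩
      · rw [← F.periodic_sub b] at hab
        exact ⟨_, F.center_P (i := i - 1) (by omega) (by omega) (by omega)
          (near_via 0 (r - 2) hab.symm (Near.refl le_rfl _)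
          (F.X_P_shift 0 (by omega) (by omega) (by omega) (by omega)) (by omega))⟩
    · exact ⟨a, F.center_P hi1 hi2 (by omega) (near_via 0 (r - 2) hab refl
        (F.X_P_shift 0 hi1 hi2 (by omega) (by omega)) (by omega))⟩

/-- Both ends lie on the T-arc. The chord is used from the position just before or just after that
arc; if it overshoots Q in one direction, it does not overshoot P (m + 1) in the other, since m ≤ r
- 2. -/
theorem chord_outside {a b : ℤ} (hab : G.Adj (X a) (X b)) (ha : r + 1 ≤ a)
    (hb : a + 2 ≤ b) (hb' : b ≤ r + 2 * m) : ∃ c, ∀ w, Near G (r - 1) (X c) w := by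
  have hm := F.one_le
  have hmr := F.le
  rcases le_or_gt (a + b) (4 * r - 3) with h | h
  · refine ⟨_, F.center_Q ?_⟩
    refine near_via (a - r) (2 * r - 2 - a) hab (F.near_X (by omega) (by omega)) ?_ (by omega)
    exact F.X_Q_shift (-1) (by omega) (by omega)
  · refine ⟨2 * m + 2 - r, F.center_P (i := m + 1) le_rfl (by omega) (by omega) ?_⟩
    refine near_via (2 * m + 1 + r - b) (b - 2 * m - 3) hab.symm
      (F.X_shift 1 (by omega) (by omega)) ?_ (by omega)
    exact F.X_P_shift 0 (by omega) (by omega) (by omega) (by omega)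

theorem chord {i j : ℤ} (hij : G.Adj (X i) (X j))
    (h : ∀ a b, X i = X a → X j = X b → b ≠ a + 1 ∧ a ≠ b + 1) :
    ∃ c, ∀ w, Near G (r - 1) (X c) w := by
  have hm := F.one_le
  have hmr := F.le
  -- The period starting at 2m + 2 - r is the P/Q window followed by the T-arc.
  obtain ⟨a, ha1, ha2, hia⟩ := F.exists_rep i (2 * m + 2 - r)
  obtain ⟨b, hb1, hb2, hjb⟩ := F.exists_rep j (2 * m + 2 - r)
  have hab : a ≠ b := by
    rintro rfl
    rw [hia, hjb] at hij
    exact G.irrefl hij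
  have h0 := h a b hia hjb
  have h1 := h (a + (2 * r - 1)) b (by rw [F.periodic_add, hia]) hjb
  have h2 := h a (b + (2 * r - 1)) hia (by rw [F.periodic_add, hjb])
  rw [hia, hjb] at hij
  rcases le_or_gt a r with har | har
  · rcases lt_or_gt_of_ne hab with hlt | hlt
    · exact F.chord_window hij ha1 har (by omega) (by omega)
    · rw [← F.periodic_add b] at hij
      exact F.chord_window hij ha1 har (by omega) (by omega)
  rcases le_or_gt b r with hbr | hbr
  · exact F.chord_window hij.symm hb1 hbr (by omega) (by omega)
  rcases lt_or_gt_of_ne hab with hlt | hlt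
  · exact F.chord_outside hij (by omega) (by omega) (by omega)
  · exact F.chord_outside hij.symm (by omega) (by omega) (by omega)

/-- The two positions opposite X (2i) between them are within r - 2 of every X b other than X (2i).
-/
theorem edge_X_P {i b : ℤ} (h1 : m + 1 ≤ i) (h2 : i ≤ r - 1) (hb : X b ≠ X (2 * i))
    (hab : G.Adj (X b) (P i)) : ∃ c, ∀ w, Near G (r - 1) (X c) w := by
  have hm := F.one_le
  have hmr := F.le
  obtain ⟨b', hb1, hb2, hbb⟩ := F.exists_rep b (2 * i)
  rw [hbb] at hab hb
  have hne : b' ≠ 2 * i := fun h => hb (by rw [h])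
  have refl : Near G 0 (P i) (P i) := Near.refl le_rfl _
  rcases le_or_gt b' (2 * i + 2 * r - 3) with h | h
  · exact ⟨_, F.center_P h1 h2 (.inl rfl) (near_via (r - 2) 0 hab
      (F.X_shift 1 (by omega) (by omega)) refl (by omega))⟩
  · exact ⟨_, F.center_P h1 h2 (.inr rfl) (near_via (r - 2) 0 hab
      (F.X_shift 1 (by omega) (by omega)) refl (by omega))⟩

theorem edge_X_Q {b : ℤ} (hb : X b ≠ X 0) (hb' : X b ≠ X 1)
    (hab : G.Adj (X b) Q) : ∃ c, ∀ w, Near G (r - 1) (X c) w := by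
  have hm := F.one_le
  have hmr := F.le
  obtain ⟨b', hb1, hb2, hbb⟩ := F.exists_rep b 0
  rw [hbb] at hab hb hb'
  have hne : b' ≠ 0 := fun h => hb (by rw [h])
  have hne' : b' ≠ 1 := fun h => hb' (by rw [h])
  exact ⟨_, F.center_Q (near_via (r - 2) 0 hab (F.near_X (by omega) (by omega))
    (Near.refl le_rfl _) (by omega))⟩

theorem edge_P_P {i j : ℤ} (hi1 : m + 1 ≤ i) (hj2 : j ≤ r - 1)
    (hij : i < j) (hab : G.Adj (P i) (P j)) : ∃ c, ∀ w, Near G (r - 1) (X c) w := by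
  have hm := F.one_le
  have hmr := F.le
  exact ⟨_, F.center_P hi1 (by omega) (.inl rfl) (near_via (r - 2) 0 hab.symm
    (F.X_P_shift 1 (by omega) hj2 (by omega) (by omega)) (Near.refl le_rfl _) (by omega))⟩

theorem edge_P_Q {i : ℤ} (h1 : m + 1 ≤ i) (h2 : i ≤ r - 1)
    (hab : G.Adj (P i) Q) : ∃ c, ∀ w, Near G (r - 1) (X c) w := by
  have hm := F.one_le
  have hmr := F.le
  exact ⟨_, F.center_P h1 h2 (.inl rfl) (near_via (r - 2) 0 hab.symm
    (F.X_Q_shift 0 (by omega) (by omega)) (Near.refl le_rfl _) (by omega))⟩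

/-- An end on the T-arc is itself the new center, because m ≤ r - 2. Otherwise the end of the T-arc
on the same side of X (m + 1) as X b gains a shorter way to T m. -/
theorem edge_X_T {b h : ℤ} (hh1 : 1 ≤ h) (hh2 : h ≤ m) (hb : X b = X (m + 1) → 2 ≤ h)
    (hab : G.Adj (X b) (T h)) : ∃ c, ∀ w, Near G (r - 1) (X c) w := by
  have hm := F.one_le
  have hmr := F.le
  obtain ⟨b', hb1, hb2, hbb⟩ := F.exists_rep b (2 * m + 2 - r)
  rw [hbb] at hab hb
  have hne : b' = m + 1 → 2 ≤ h := fun h => hb (by rw [h])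
  have top : Near G (m - h) (T h) (T m) := F.near_T_T hh1 hh2 hm le_rfl (by omega) (by omega)
  rcases le_or_gt (r + 1) b' with hbr | hbr
  · exact ⟨b', F.center_T hbr (by omega) fun g hg1 hg2 => near_via 0 (r - 2) hab
      (Near.refl le_rfl _) (F.near_T_T hh1 hh2 hg1 hg2 (by omega) (by omega)) (by omega)⟩
  rcases le_or_gt (m + 1) b' with hbm | hbm
  · exact ⟨r + 1, F.center_T_top (.inl rfl) (near_via (r + 1 - b') (m - h) hab
      (F.near_X (by omega) (by omega)) top (by omega))⟩
  · exact ⟨r + 2 * m, F.center_T_top (.inr rfl) (near_via (b' - (2 * m + 1 - r)) (m - h) hab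
      (F.X_shift (-1) (by omega) (by omega)) top (by omega))⟩

theorem edge_P_T {i h : ℤ} (h1 : m + 1 ≤ i) (h2 : i ≤ r - 1) (hh1 : 1 ≤ h) (hh2 : h ≤ m)
    (hab : G.Adj (P i) (T h)) : ∃ c, ∀ w, Near G (r - 1) (X c) w := by
  have hm := F.one_le
  have hmr := F.le
  have top : Near G (m - h) (T h) (T m) := F.near_T_T hh1 hh2 hm le_rfl (by omega) (by omega)
  rcases le_or_gt (2 * i) r with hir | hir
  · exact ⟨r + 1, F.center_T_top (.inl rfl) (near_via (r + 2 - 2 * i) (m - h) hab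
      (F.X_P_shift 0 h1 h2 (by omega) (by omega)) top (by omega))⟩
  rcases le_or_gt (2 * i) (r + 2 * m) with him | him
  · exact ⟨2 * i, F.center_T (by omega) him fun g hg1 hg2 => near_via 1 (r - 3) hab
      (F.near_X_P h1 h2) (F.near_T_T hh1 hh2 hg1 hg2 (by omega) (by omega)) (by omega)⟩
  · exact ⟨r + 2 * m, F.center_T_top (.inr rfl) (near_via (2 * i - (r + 2 * m) + 1) (m - h) hab
      (F.X_P_shift 0 h1 h2 (by omega) (by omega)) top (by omega))⟩

theorem edge_Q_T {h : ℤ} (hh1 : 1 ≤ h) (hh2 : h ≤ m)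
    (hab : G.Adj Q (T h)) : ∃ c, ∀ w, Near G (r - 1) (X c) w := by
  have hm := F.one_le
  have hmr := F.le
  rcases le_or_gt (2 * r - 1) (r + 2 * m) with him | him
  · exact ⟨2 * r - 1, F.center_T (by omega) him fun g hg1 hg2 => near_via 1 (r - 3) hab
      (F.X_Q_shift (-1) (by omega) (by omega))
      (F.near_T_T hh1 hh2 hg1 hg2 (by omega) (by omega)) (by omega)⟩
  · have top : Near G (m - h) (T h) (T m) := F.near_T_T hh1 hh2 hm le_rfl (by omega) (by omega)
    exact ⟨r + 2 * m, F.center_T_top (.inr rfl) (near_via (r - 2 * m) (m - h) hab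
      (F.X_Q_shift (-1) (by omega) (by omega)) top (by omega))⟩

theorem edge_T_T {g h : ℤ} (hg1 : 1 ≤ g) (hgh : g + 2 ≤ h) (hh2 : h ≤ m)
    (hab : G.Adj (T g) (T h)) : ∃ c, ∀ w, Near G (r - 1) (X c) w := by
  have hm := F.one_le
  have hmr := F.le
  have top : Near G (m - h) (T h) (T m) :=
    F.near_T_T (by omega) hh2 hm le_rfl (by omega) (by omega)
  exact ⟨r + 1, F.center_T_top (.inl rfl) (near_via (r - m + g) (m - h) hab
    (F.X_T_shift 0 hg1 (by omega) (by omega) (by omega)) top (by omega))⟩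

end Frame

/-- Every additional edge yields a vertex of the closed walk with eccentricity less than `r`. -/
theorem Frame.exists_shrink {G : SimpleGraph W} {r m : ℤ} {X P T : ℤ → W} {Q : W}
    (F : Frame G r m X P T Q) {a b : W} (hne : a ≠ b) (hadj : ¬ G.Adj a b) :
    ∃ c, ∀ w, Near (G ⊔ SimpleGraph.edge a b) (r - 1) (X c) w := by
  have hm := F.one_le
  have hmr := F.le
  have F' := F.of_le (le_sup_left : G ≤ G ⊔ SimpleGraph.edge a b)
  have hab : (G ⊔ SimpleGraph.edge a b).Adj a b :=
    Or.inr (by simp [SimpleGraph.edge_adj, hne])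
  set G' := G ⊔ SimpleGraph.edge a b with hG'
  clear_value G'
  have hXP : ∀ {j i}, m + 1 ≤ i → i ≤ r - 1 → ¬ G.Adj (X j) (P i) → G'.Adj (X j) (P i) →
      ∃ c, ∀ w, Near G' (r - 1) (X c) w := fun h1 h2 hadj =>
    F'.edge_X_P h1 h2 fun h => hadj (by rw [h]; exact (F.adj_P _ h1 h2).symm)
  have hXQ : ∀ {j}, ¬ G.Adj (X j) Q → G'.Adj (X j) Q →
      ∃ c, ∀ w, Near G' (r - 1) (X c) w := fun hadj =>
    F'.edge_X_Q (fun h => hadj (by rw [h]; exact F.adj_Q.symm))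
      fun h => hadj (by rw [h]; exact F.adj_Q'.symm)
  have hXT : ∀ {j h}, 1 ≤ h → h ≤ m → ¬ G.Adj (X j) (T h) → G'.Adj (X j) (T h) →
      ∃ c, ∀ w, Near G' (r - 1) (X c) w := by
    refine fun h1 h2 hadj => F'.edge_X_T h1 h2 fun hb => ?_
    refine (eq_or_lt_of_le h1).resolve_left fun h => hadj ?_
    rw [hb, ← h]
    exact F.adj_T_one.symm
  have hTT : ∀ {g h}, 1 ≤ g → h ≤ m → g < h → ¬ G.Adj (T g) (T h) → G'.Adj (T g) (T h) →
      ∃ c, ∀ w, Near G' (r - 1) (X c) w := by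
    intro g h h1 h2 hgh hadj
    have hne : h ≠ g + 1 := by
      rintro rfl
      exact hadj (F.adj_T g h1 (by omega))
    exact F'.edge_T_T h1 (by omega) h2
  have hadj' : ¬ G.Adj b a := fun h => hadj h.symm
  rcases F.cases a with ⟨i, rfl⟩ | ⟨i, hi1, hi2, rfl⟩ | rfl | ⟨g, hg1, hg2, rfl⟩ <;>
    rcases F.cases b with ⟨j, rfl⟩ | ⟨j, hj1, hj2, rfl⟩ | rfl | ⟨h, hh1, hh2, rfl⟩
  · refine F'.chord hab fun a b ha hb => ⟨?_, ?_⟩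
    · rintro rfl
      exact hadj (by rw [ha, hb]; exact F.adj_X a)
    · rintro rfl
      exact hadj (by rw [ha, hb]; exact (F.adj_X b).symm)
  · exact hXP hj1 hj2 hadj hab
  · exact hXQ hadj hab
  · exact hXT hh1 hh2 hadj hab
  · exact hXP hi1 hi2 hadj' hab.symm
  · rcases lt_trichotomy i j with hij | rfl | hij
    · exact F'.edge_P_P hi1 hj2 hij hab
    · exact (hne rfl).elim
    · exact F'.edge_P_P hj1 hi2 hij hab.symm
  · exact F'.edge_P_Q hi1 hi2 hab
  · exact F'.edge_P_T hi1 hi2 hh1 hh2 hab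
  · exact hXQ hadj' hab.symm
  · exact F'.edge_P_Q hj1 hj2 hab.symm
  · exact (hne rfl).elim
  · exact F'.edge_Q_T hh1 hh2 hab
  · exact hXT hg1 hg2 hadj' hab.symm
  · exact F'.edge_P_T hj1 hj2 hg1 hg2 hab.symm
  · exact F'.edge_Q_T hg1 hg2 hab.symm
  · rcases lt_trichotomy g h with hgh | rfl | hgh
    · exact hTT hg1 hh2 hgh hadj hab
    · exact (hne rfl).elim
    · exact hTT hh1 hg2 hgh hadj' hab.symm

/-! ### Leaves, residues and cyclic distance -/

theorem Near.of_leaf {V : Type*} {G : SimpleGraph V} {k : ℤ} {u p v : V}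
    (hp : ∀ x, G.Adj p x → x = v) (hu : u ≠ p) (h : Near G k u p) : Near G (k - 1) u v := by
  obtain ⟨q, hq⟩ := h.symm
  cases q with
  | nil => exact (hu rfl).elim
  | cons hadj q =>
    obtain rfl := hp _ hadj
    rw [SimpleGraph.Walk.length_cons] at hq
    push_cast at hq
    exact Near.symm ⟨q, by omega⟩

theorem emod_add_one_cases {n : ℤ} (hn : 0 < n) (i : ℤ) :
    (i + 1) % n = i % n + 1 ∨ (i % n = n - 1 ∧ (i + 1) % n = 0) := by
  have h0 := Int.emod_nonneg i hn.ne'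
  have h1 := Int.emod_lt_of_pos i hn
  have h2 : (i + 1) % n = (i % n + 1) % n := by simp
  rcases eq_or_ne (i % n) (n - 1) with h | h
  · right
    refine ⟨h, ?_⟩
    rw [h2, h]
    simp
  · left
    rw [h2]
    exact Int.emod_eq_of_lt (by omega) (by omega)

/-- The distance of the positions `a` and `b` on a cycle of length `n`, if `0 ≤ a, b < n`. -/
def cycDist (n a b : ℤ) : ℤ := min (max (a - b) (b - a)) (n - max (a - b) (b - a))

/-! ### The graph `H` -/

section graphH

variable {r d : ℕ}

/-- The vertex `x_i`, for `i` modulo `2r - 1`. -/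
def xVertex (hr : 0 < r) (i : ℤ) : Fin (2 * r - 1) ⊕ Fin r :=
  .inl ⟨((i - 1) % (2 * r - 1)).toNat, by
    have h0 := Int.emod_nonneg (i - 1) (b := 2 * (r : ℤ) - 1) (by omega)
    have h1 := Int.emod_lt_of_pos (i - 1) (b := 2 * (r : ℤ) - 1) (by omega)
    omega⟩

/-- The vertex `y_{b+1}`. -/
def yVertex (hr : 0 < r) (b : ℤ) : Fin (2 * r - 1) ⊕ Fin r :=
  -- The value outside 0 ≤ b < r is irrelevant: a frame uses P and T only within their ranges.
  if h : b.toNat < r then .inr ⟨b.toNat, h⟩ else .inr ⟨0, hr⟩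

theorem xVertex_eq (hr : 0 < r) {i : ℤ} {n : ℕ} (hn : n < 2 * r - 1) (hi : i = n + 1) :
    xVertex hr i = .inl ⟨n, hn⟩ := by
  subst hi
  have : ((n : ℤ) + 1 - 1) % (2 * r - 1) = n := by
    rw [add_sub_cancel_right]
    exact Int.emod_eq_of_lt (by omega) (by omega)
  simp only [xVertex, this, Int.toNat_natCast]

theorem xVertex_periodic (hr : 0 < r) (i k : ℤ) :
    xVertex hr (i + (2 * r - 1) * k) = xVertex hr i := by
  have : (i + (2 * r - 1) * k - 1) % (2 * (r : ℤ) - 1) = (i - 1) % (2 * r - 1) := by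
    rw [show i + (2 * r - 1) * k - 1 = i - 1 + (2 * r - 1) * k by ring, Int.add_mul_emod_self_left]
  simp only [xVertex, this]

theorem yVertex_eq (hr : 0 < r) {b : ℤ} {n : ℕ} (hn : n < r) (hb : b = n) :
    yVertex hr b = .inr ⟨n, hn⟩ := by
  subst hb
  simp [yVertex, hn]

theorem graphH_adj_of_rel {u v : Fin (2 * r - 1) ⊕ Fin r} (huv : u ≠ v) (h : hRel r d u v) :
    (graphH r d).Adj u v :=
  (SimpleGraph.fromRel_adj _ _ _).2 ⟨huv, .inl h⟩

theorem graphH_frame (hr : 0 < r) (hrd : r < d) (hd : d + 2 ≤ 2 * r) :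
    Frame (graphH r d) r (d - r) (xVertex hr) (fun i => yVertex hr (r - i))
      (fun h => yVertex hr (2 * r - d + h - 1)) (yVertex hr 0) where
  one_le := by omega
  le := by omega
  adj_X i := by
    have h0 := Int.emod_nonneg (i - 1) (b := 2 * (r : ℤ) - 1) (by omega)
    have h := emod_add_one_cases (n := 2 * (r : ℤ) - 1) (by omega) (i - 1)
    rw [show i - 1 + 1 = i + 1 - 1 by ring] at h
    refine graphH_adj_of_rel ?_ ?_
    · simp only [xVertex, ne_eq, Sum.inl.injEq, Fin.mk.injEq]
      omega
    · simp only [xVertex, hRel]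
      omega
  periodic := xVertex_periodic hr
  adj_P i h1 h2 := by
    rw [xVertex_eq hr (n := (2 * i - 1).toNat) (by omega) (by omega),
      yVertex_eq hr (n := (r - i).toNat) (by omega) (by omega)]
    refine (graphH_adj_of_rel (by simp) ?_).symm
    simp only [hRel]
    omega
  adj_Q := by
    rw [← xVertex_periodic hr 0 1, xVertex_eq hr (n := 2 * r - 2) (by omega) (by omega),
      yVertex_eq hr (b := 0) (n := 0) hr rfl]
    refine (graphH_adj_of_rel (by simp) ?_).symm
    simp only [hRel, and_true]
    omega
  adj_Q' := by
    rw [xVertex_eq hr (n := 0) (by omega) (by omega), yVertex_eq hr (b := 0) (n := 0) hr rfl]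
    refine (graphH_adj_of_rel (by simp) ?_).symm
    exact .inr (.inl ⟨by simp only; omega, .inr ⟨rfl, rfl⟩⟩)
  adj_T_one := by
    rw [xVertex_eq hr (n := d - r) (by omega) (by omega),
      yVertex_eq hr (n := 2 * r - d) (by omega) (by omega)]
    refine (graphH_adj_of_rel (by simp) ?_).symm
    simp only [hRel]
    omega
  adj_T h h1 h2 := by
    rw [yVertex_eq hr (n := (2 * r - d + h - 1).toNat) (by omega) (by omega),
      yVertex_eq hr (n := (2 * r - d + h).toNat) (by omega) (by omega)]
    refine graphH_adj_of_rel ?_ ?_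
    · simp only [ne_eq, Sum.inr.injEq, Fin.mk.injEq]
      omega
    · simp only [hRel]
      omega
  cases := by
    rintro (⟨a, ha⟩ | ⟨b, hb⟩)
    · exact .inl ⟨a + 1, (xVertex_eq hr ha rfl).symm⟩
    · rcases Nat.eq_zero_or_pos b with rfl | hb0
      · exact .inr (.inr (.inl (yVertex_eq hr hb rfl).symm))
      rcases lt_or_ge b (2 * r - d) with hbd | hbd
      · exact .inr (.inl ⟨r - b, by omega, by omega, (yVertex_eq hr hb (by omega)).symm⟩)
      · exact .inr (.inr (.inr ⟨b - (2 * r - d) + 1, by omega, by omega,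
          (yVertex_eq hr hb (by omega)).symm⟩))

/-- A lower bound for the distance from `x_{c+1}`; the pendant vertices may be given
a height `ε` of either sign. -/
def heightFun (r d : ℕ) (c ε : ℤ) : Fin (2 * r - 1) ⊕ Fin r → ℤ
  | .inl a => cycDist (2 * r - 1) a c
  | .inr b =>
      if b.val = 0 then
        min (cycDist (2 * r - 1) 0 c) (cycDist (2 * r - 1) (2 * r - 2) c) + 1
      else if b.val + d < 2 * r then cycDist (2 * r - 1) (2 * r - 2 * b - 1) c + ε
      else cycDist (2 * r - 1) (d - r) c + (b + d - 2 * r + 1)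

theorem heightFun_rel (hrd : r < d) (hd : d + 2 ≤ 2 * r) {c ε : ℤ} (hc : 0 ≤ c)
    (hc' : c < 2 * r - 1) (hε : ε = 1 ∨ ε = -1) {u v : Fin (2 * r - 1) ⊕ Fin r}
    (h : hRel r d u v) :
    heightFun r d c ε v ≤ heightFun r d c ε u + 1 ∧
      heightFun r d c ε u ≤ heightFun r d c ε v + 1 := by
  rcases u with ⟨a, ha⟩ | ⟨a, ha⟩ <;> rcases v with ⟨b, hb⟩ | ⟨b, hb⟩
  · simp only [hRel] at h
    simp only [heightFun, cycDist]
    omega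
  · simp only [hRel] at h
    simp only [heightFun, cycDist]
    split_ifs <;> omega
  · exact h.elim
  · simp only [hRel] at h
    simp only [heightFun, cycDist]
    split_ifs <;> omega

theorem heightFun_sub_le (hrd : r < d) (hd : d + 2 ≤ 2 * r) {c ε : ℤ} (hc : 0 ≤ c)
    (hc' : c < 2 * r - 1) (hε : ε = 1 ∨ ε = -1) {u v : Fin (2 * r - 1) ⊕ Fin r} {k : ℤ}
    (h : Near (graphH r d) k u v) : heightFun r d c ε v - heightFun r d c ε u ≤ k :=
  h.sub_le fun _ _ hab => by
    rcases ((SimpleGraph.fromRel_adj _ _ _).1 hab).2 with h | h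
    · exact (heightFun_rel hrd hd hc hc' hε h).1
    · exact (heightFun_rel hrd hd hc hc' hε h).2

theorem graphH_far (hrd : r < d) (hd : d + 2 ≤ 2 * r) (u : Fin (2 * r - 1) ⊕ Fin r) :
    ∃ w, ∀ k, Near (graphH r d) k u w → (r : ℤ) ≤ k := by
  rcases u with ⟨a, ha⟩ | ⟨b, hb⟩
  · obtain ⟨b, hb, h⟩ : ∃ b, ∃ hb : b < r, (r : ℤ) ≤ heightFun r d a 1 (.inr ⟨b, hb⟩) := by
      rcases eq_or_ne (a + 1) r with har | har
      · refine ⟨0, by omega, ?_⟩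
        simp only [heightFun, cycDist]
        omega
      -- `h1` and `h2` say that c = a + 1, respectively c = a + 2 - 2r, lies in the window of the
      -- P's; then i = ⌊(c + r)/2⌋. All remaining positions use T m.
      by_cases h1 : a + 1 < r ∧ 2 * d + 1 ≤ 3 * r + a
      · refine ⟨r - (a + 1 + r) / 2, by omega, ?_⟩
        simp only [heightFun, cycDist]
        rw [if_neg (by omega), if_pos (by omega)]
        omega
      by_cases h2 : 2 * d ≤ r + a
      · refine ⟨r - (a + 2 - r) / 2, by omega, ?_⟩
        simp only [heightFun, cycDist]
        rw [if_neg (by omega), if_pos (by omega)]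
        omega
      · refine ⟨r - 1, by omega, ?_⟩
        simp only [heightFun, cycDist]
        rw [if_neg (by omega), if_neg (by omega)]
        omega
    refine ⟨.inr ⟨b, hb⟩, fun k hk => ?_⟩
    have := heightFun_sub_le (c := a) hrd hd (by omega) (by omega) (.inl rfl) hk
    have h0 : heightFun r d a 1 (.inl ⟨a, ha⟩) = 0 := by
      simp only [heightFun, cycDist]
      omega
    omega
  · obtain ⟨a, ha, h⟩ : ∃ a, ∃ _ : a < 2 * r - 1, (r : ℤ) ≤ heightFun r d a 1 (.inr ⟨b, hb⟩) := by
      rcases eq_or_ne b 0 with rfl | hb0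
      · refine ⟨r - 1, by omega, ?_⟩
        simp only [heightFun, cycDist]
        omega
      by_cases hbd : b + d < 2 * r
      · by_cases hbr : r ≤ 2 * r - 2 * b - 1
        · refine ⟨2 * r - 2 * b - 1 - r, by omega, ?_⟩
          simp only [heightFun, cycDist]
          rw [if_neg (by omega), if_pos (by omega)]
          omega
        · refine ⟨3 * r - 2 * b - 2, by omega, ?_⟩
          simp only [heightFun, cycDist]
          rw [if_neg (by omega), if_pos (by omega)]
          omega
      · refine ⟨d - 1, by omega, ?_⟩
        simp only [heightFun, cycDist]
        rw [if_neg (by omega), if_neg (by omega)]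
        omega
    refine ⟨.inl ⟨a, ha⟩, fun k hk => ?_⟩
    have := heightFun_sub_le (c := a) hrd hd (by omega) (by omega) (.inl rfl) hk.symm
    have h0 : heightFun r d a 1 (.inl ⟨a, ha⟩) = 0 := by
      simp only [heightFun, cycDist]
      omega
    omega

/-- The pair is P i with i = ⌈d/2⌉, and T m; their feet on the cycle are r - 1 apart. Taking ε = -1
puts P i one below its foot, so the heights differ by 1 + (r - 1) + (d - r) = d. -/
theorem graphH_far_pair (hrd : r < d) (hd : d + 2 ≤ 2 * r) :
    ∃ u w, ∀ k, Near (graphH r d) k u w → (d : ℤ) ≤ k := by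
  refine ⟨.inr ⟨r - (d + 1) / 2, by omega⟩, .inr ⟨r - 1, by omega⟩, fun k hk => ?_⟩
  have := heightFun_sub_le (c := 2 * ((d + 1) / 2 : ℕ) - 1) hrd hd (by omega) (by omega)
    (.inr rfl) hk
  simp only [heightFun, cycDist] at this
  rw [if_neg (by omega), if_neg (by omega), if_neg (by omega), if_pos (by omega)] at this
  omega

theorem graphH_leaf (hrd : r < d) (hd : d + 2 ≤ 2 * r) {x : Fin (2 * r - 1) ⊕ Fin r}
    (h : (graphH r d).Adj (.inr ⟨1, by omega⟩) x) : x = .inl ⟨2 * r - 3, by omega⟩ := by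
  rcases ((SimpleGraph.fromRel_adj _ _ _).1 h).2 with h | h <;>
    rcases x with ⟨a, ha⟩ | ⟨b, hb⟩ <;> simp only [hRel] at h
  · omega
  · simp only [Sum.inl.injEq, Fin.mk.injEq]
    omega
  · omega

theorem graphH_invariant (hrd : r < d) (hd : d + 2 ≤ 2 * r) :
    ExtInvariant (graphH r d) (.inl ⟨2 * r - 3, by omega⟩) r d := by
  have hr : 0 < r := by omega
  have F := graphH_frame hr hrd hd
  refine ⟨by omega, graphH_far hrd hd, F.exists_center, fun u w => (F.near_all u w).mono (by omega),
    graphH_far_pair hrd hd, fun a b hab hadj => ?_⟩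
  obtain ⟨c, hc⟩ := F.exists_shrink hab hadj
  refine ⟨_, hc, ?_⟩
  rintro rfl
  have hleaf : (graphH r d).Adj (.inl ⟨2 * r - 3, by omega⟩) (.inr ⟨1, by omega⟩) := by
    refine graphH_adj_of_rel (by simp) ?_
    simp only [hRel]
    omega
  -- The new edge is at x_{2r-2} and does not end in y_2, which is already adjacent, so y_2 remains
  -- a leaf. A center within r - 1 of y_2 is within r - 2 of its only neighbour.
  refine (Near.of_leaf (p := .inr ⟨1, by omega⟩) ?_ (by simp [xVertex]) (hc _)).mono (by omega)
  intro x hx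
  rcases (SimpleGraph.sup_adj _ _ _ _).1 hx with hx | hx
  · exact graphH_leaf hrd hd hx
  · rcases ((SimpleGraph.edge_adj _ _ _ _).1 hx).1 with ⟨h, -⟩ | ⟨h, -⟩
    · simp at h
    · rw [← h] at hadj
      exact (hadj hleaf).elim

end graphH

/-! ### The cycle -/

section cycle

variable {r : ℕ}

theorem cycleGraph_adj_val {n : ℕ} {a b : Fin n} : (SimpleGraph.cycleGraph n).Adj a b ↔
    2 ≤ n ∧ (b.val = a.val + 1 ∨ a.val = b.val + 1 ∨ (a.val = 0 ∧ b.val + 1 = n) ∨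
      (b.val = 0 ∧ a.val + 1 = n)) := by
  rw [SimpleGraph.cycleGraph_adj']
  rcases lt_trichotomy a b with h | rfl | h
  · rw [Fin.coe_sub_iff_lt.2 h, Fin.coe_sub_iff_le.2 h.le]
    have := b.2
    rw [Fin.lt_def] at h
    omega
  · rw [Fin.coe_sub_iff_le.2 le_rfl]
    omega
  · rw [Fin.coe_sub_iff_lt.2 h, Fin.coe_sub_iff_le.2 h.le]
    have := a.2
    rw [Fin.lt_def] at h
    omega

theorem cycleGraph_invariant (hr : 2 ≤ r) (v : Fin (2 * r)) :
    ExtInvariant (SimpleGraph.cycleGraph (2 * r)) v r r := by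
  let X : ℤ → Fin (2 * r) := fun i => ⟨(i % (2 * r)).toNat, by
    have h0 := Int.emod_nonneg i (b := 2 * (r : ℤ)) (by omega)
    have h1 := Int.emod_lt_of_pos i (b := 2 * (r : ℤ)) (by omega)
    omega⟩
  have hX : ∀ i, (SimpleGraph.cycleGraph (2 * r)).Adj (X i) (X (i + 1)) := fun i => by
    have h0 := Int.emod_nonneg i (b := 2 * (r : ℤ)) (by omega)
    have h := emod_add_one_cases (n := 2 * (r : ℤ)) (by omega) i
    rw [cycleGraph_adj_val]
    simp only [X]
    omega
  have hper : ∀ i, X (i - 2 * r) = X i := fun i => by simp [X]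
  have hval : ∀ a : Fin (2 * r), X a.val = a := fun a => by
    have : (a.val : ℤ) % (2 * r) = a.val := Int.emod_eq_of_lt (by omega) (by omega)
    simp [X, this]
  have hrep : ∀ (i : ℤ) (a : Fin (2 * r)), ∃ t : ℤ, 0 ≤ t ∧ t < 2 * r ∧ a = X (i + t) := by
    intro i a
    refine ⟨(a.val - i) % (2 * r), Int.emod_nonneg _ (by omega), Int.emod_lt_of_pos _ (by omega), ?_⟩
    rw [Fin.ext_iff]
    have : (i + (a.val - i) % (2 * r)) % (2 * (r : ℤ)) = a.val := by
      rw [Int.add_emod, Int.emod_emod, ← Int.add_emod, add_sub_cancel]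
      exact Int.emod_eq_of_lt (by omega) (by omega)
    simp [X, this]
  have hnear : ∀ {G : SimpleGraph (Fin (2 * r))} {i j k : ℤ}, SimpleGraph.cycleGraph (2 * r) ≤ G →
      i - j ≤ k → j - i ≤ k → Near G k (X i) (X j) := fun hG h h' =>
    Near.of_sequence (fun i => hG (hX i)) h h'
  have hall : ∀ u w, Near (SimpleGraph.cycleGraph (2 * r)) r u w := by
    intro u w
    obtain ⟨t, ht0, ht, rfl⟩ := hrep u.val w
    rcases le_or_gt t r with h | h
    · have := hnear (i := u.val) (j := u.val + t) (k := r) le_rfl (by omega) (by omega)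
      rwa [hval] at this
    · have := hnear (i := u.val) (j := u.val + t - 2 * r) (k := r) le_rfl (by omega) (by omega)
      rwa [hval, hper] at this
  have hfar : ∀ u, ∃ w, ∀ k, Near (SimpleGraph.cycleGraph (2 * r)) k u w → (r : ℤ) ≤ k := by
    intro u
    obtain ⟨w, hw⟩ : ∃ w : Fin (2 * r), w.val = u.val + r ∨ u.val = w.val + r := by
      rcases lt_or_ge u.val r with h | h
      · exact ⟨⟨u.val + r, by omega⟩, .inl rfl⟩
      · exact ⟨⟨u.val - r, by omega⟩, .inr (by simp only; omega)⟩
    refine ⟨w, fun k hk => ?_⟩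
    have := hk.sub_le (f := fun z => cycDist (2 * r) z.val u.val) fun a b hab => by
      rw [cycleGraph_adj_val] at hab
      simp only [cycDist]
      omega
    simp only [cycDist] at this
    omega
  -- The new center is a itself, so the clause at v only needs 0 ≤ r - 2.
  refine ⟨by omega, hfar, ⟨v, hall v⟩, hall, ⟨v, hfar v⟩, fun a b hab hadj => ⟨a, ?_, ?_⟩⟩
  · have hadj' : (SimpleGraph.cycleGraph (2 * r) ⊔ SimpleGraph.edge a b).Adj a b :=
      Or.inr (by simp [SimpleGraph.edge_adj, hab])
    obtain ⟨s, hs0, hs, hb⟩ := hrep a.val b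
    have hs2 : s ≠ 0 ∧ s ≠ 1 ∧ s ≠ 2 * r - 1 := by
      refine ⟨?_, ?_, ?_⟩
      · rintro rfl
        rw [add_zero, hval] at hb
        exact hab hb.symm
      · rintro rfl
        apply hadj
        rw [hb]
        simpa only [hval] using hX a.val
      · rintro rfl
        apply hadj
        have := hX (a.val - 1)
        rw [sub_add_cancel, hval] at this
        rw [hb, ← hper, show (a.val : ℤ) + (2 * r - 1) - 2 * r = a.val - 1 by ring]
        exact this.symm
    intro w
    obtain ⟨t, ht0, ht, rfl⟩ := hrep a.val w
    rcases lt_trichotomy t r with h | h | h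
    · have := hnear (i := a.val) (j := a.val + t) (k := r - 1)
        (le_sup_left (b := SimpleGraph.edge a b)) (by omega) (by omega)
      rwa [hval] at this
    -- The antipode of a alone needs the chord: b is at least two steps from a on either side, hence
    -- within r - 2 of it.
    · refine ((Near.of_adj hadj').trans (l := r - 2) ?_).mono (by omega)
      have := hnear (i := a.val + s) (j := a.val + t) (k := r - 2)
        (le_sup_left (b := SimpleGraph.edge a b)) (by omega) (by omega)
      rwa [← hb] at this
    · have := hnear (i := a.val) (j := a.val + t - 2 * r) (k := r - 1)
        (le_sup_left (b := SimpleGraph.edge a b)) (by omega) (by omega)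
      rwa [hval, hper] at this
  · rintro rfl
    exact Near.refl (by omega) _

end cycle

end RadialMax

theorem theorem2 (r d n : ℕ) :
    (2 ≤ r → 2 * r ≤ n →
      ∀ v : Fin (2 * r), ∃ G : SimpleGraph (Fin n),
        RadialMax.IsRadiallyMaximal G ∧ RadialMax.IsSelfCentered G ∧ G.radius = (r : ℕ∞) ∧
        Nonempty (G ≃g
          RadialMax.iterExtension (SimpleGraph.cycleGraph (2 * r)) v (n - 2 * r))) ∧
    (∀ (hrd : r < d) (_hd : d ≤ 2 * r - 2), 3 * r - 1 ≤ n →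
      ∃ G : SimpleGraph (Fin n),
        RadialMax.IsRadiallyMaximal G ∧ G.radius = (r : ℕ∞) ∧ G.ediam = (d : ℕ∞) ∧
        -- the extensions are made at the vertex `x_{2r-2}`
        Nonempty (G ≃g
          RadialMax.iterExtension (RadialMax.graphH r d)
            (Sum.inl ⟨2 * r - 3, by omega⟩) (n - (3 * r - 1)))) := by
  constructor
  · intro hr hn v
    obtain ⟨G, w, hG, e⟩ := (RadialMax.cycleGraph_invariant hr v).exists_fin (Equiv.refl _) hn
    exact ⟨G, hG.isRadiallyMaximal, hG.radius_eq.trans hG.ediam_eq.symm, hG.radius_eq, e⟩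
  · intro hrd hd hn
    have e : Fin (2 * r - 1) ⊕ Fin r ≃ Fin (3 * r - 1) :=
      finSumFinEquiv.trans (finCongr (by omega))
    obtain ⟨G, w, hG, e⟩ :=
      (RadialMax.graphH_invariant hrd (by omega)).exists_fin e hn
    exact ⟨G, hG.isRadiallyMaximal, hG.radius_eq, hG.ediam_eq, e⟩
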